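/- Let $\mathbb F$ be a field and $n$ a natural number. For $v,w\in\mathbb N^n$ write $v\preceq w$ for the componentwise order and $v\prec w$ if $v\preceq w$ and $v\neq w$. Let $\xi_0=(V_0,\mu_0)$ and $\xi_1=(V_1,\mu_1)$ be finite $n$-dimensional multisets, i.e. $V_i\subseteq\mathbb N^n$ is finite and $\mu_i:V_i\to\mathbb N_{\ge 1}$. Put $m_0=\sum_{v\in V_0}\mu_0(v)$ and, for $w \in \mathbb N^n$, let $\delta_1(w)$ be the $\mathbb F$-dimension of the degree $w$ part of the $\mathbb N^n$-graded free module $\bigoplus_{v\in V_1}A(v)^{\mu_1(v)}$ over $A=\mathbb F[x_1,\dots,x_n]$, where $A(v)$ is $A$ with its grading shifted upwards by $v$: $A(v)_w=A_{w-v}$ if $v\preceq w$ and $A(v)_w=0$ otherwise. Fix an enumeration of $V_0$ and identify $\mathbb F^{m_0}=\bigoplus_{v\in V_0}\mathbb F^{\mu_0(v)}$ along it, with projections $\pi_v:\mathbb F^{m_0}\to\mathbb F^{\mu_0(v)}$. Let $\mathrm G_{\mathbb F}(d,m)$ be the set of $d$-dimensional subspaces of $\mathbb F^m$. Let $Y_n^{\mathbb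 F}(\xi_0,\xi_1)\subseteq\prod_{w\in V_1}\mathrm G_{\mathbb F}(\delta_1(w),m_0)$ be the set of framed relation families, i.e. of the families $(L_w)_{w\in V_1}$ such that for all $w\in V_1$: 1. $\pi_v(L_w)=0$ for all $v\in V_0$ with $v\nprec w$; 2. $L_v\subseteq L_w$ for all $v\in V_1$ with $v\prec w$; 3. $\dim_{\mathbb F}\bigl(L_w/\sum_{v\in V_1,\,v\prec w}L_v\bigr)=\mu_1(w)$. Let $\mathcal G_{\mathbb F}(d,m)$ be the Grassmann scheme over $\mathbb F$: it is glued from the affine charts $\mathcal W(I)$, where $I$ runs through the $d$-element subsets of $\{1,\dots,m\}$ and $\mathcal W(I)$ is the scheme of $d\times m$ matrices $M$ whose submatrix $M_I$ of columns in $I$ is the identity, along the isomorphisms $M\mapsto M_J^{-1}M$ between the open subschemes $\{\det M_J\neq 0\}\subseteq\mathcal W(I)$ and $\{\det M_I\ne 0\}\subseteq\mathcal W(J)$; it is empty if $d>m$. An $\mathbb F$-point of $\mathcal G_{\mathbb F}(d,m)$ given by a matrix $M$ in some chart corresponds to the row space of $M$ in $\mathrm G_{\mathbb F}(d,m)$.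 An $\mathbb F$-variety is an $\mathbb F$-scheme that is a finite union of open subschemes, each the spectrum of a finitely generated $\mathbb F$-algebra. A subprevariety of an $\mathbb F$-variety $X$ is an $\mathbb F$-variety that is an open subscheme of a closed subscheme $Z\subseteq X$, where $Z$ is an $\mathbb F$-variety. **Theorem.** There exist a subprevariety $$\mathcal Y_n^{\mathbb F}(\xi_0,\xi_1)\subseteq\prod_{w\in V_1}\mathcal G_{\mathbb F}(\delta_1(w),m_0)$$ (fibre product over $\mathbb F$) and a bijection $$\mathcal Y_n^{\mathbb F}(\xi_0,\xi_1)(\mathbb F)\xrightarrow{\ \sim\ }Y_n^{\mathbb F}(\xi_0,\xi_1),$$ which is induced by the correspondence between $\mathbb F$-points and subspaces: if $y$ is mapped to $(L_w)_{w\in V_1}$, then for each $w\in V_1$ the $w$-component of $y$, an $\mathbb F$-point of $\mathcal G_{\mathbb F}(\delta_1(w),m_0)$, corresponds to $L_w$. -/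

import Mathlib

open AlgebraicGeometry CategoryTheory Limits
universe u

/-! The Grassmann scheme of `d`-dimensional subspaces of `F^m`, glued from its standard affine charts -/
namespace FramedRelations
noncomputable section
variable (F : Type u) [Field F] (d m : ℕ)

/-- The ideal generated by the entries of `(x_{ij})_I - 1`, for a `d`-subset `I` of the columns. -/
def chartIdeal (I : Fin d ↪o Fin m) : Ideal (MvPolynomial (Fin d × Fin m) F) :=
  Ideal.span (Set.range fun p : Fin d × Fin d =>
    MvPolynomial.X (p.1, I p.2) - MvPolynomial.C ((1 : Matrix (Fin d) (Fin d) F) p.1 p.2))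

/-- The coordinate ring of the chart `I`, whose `T`-points are the `d × m` matrices `M` over `T`
with `M_I = 1`. -/
abbrev ChartRing (I : Fin d ↪o Fin m) : Type u :=
  MvPolynomial (Fin d × Fin m) F ⧸ chartIdeal F d m I

variable {d m}
/-- The `d × m` matrix of coordinates on the chart `I`. -/
def genericMatrix (I : Fin d ↪o Fin m) : Matrix (Fin d) (Fin m) (ChartRing F d m I) :=
  Matrix.of fun a b => Ideal.Quotient.mk _ (MvPolynomial.X (a, b))

lemma genericMatrix_submatrix (I : Fin d ↪o Fin m) :
    (genericMatrix F I).submatrix id I = 1 := by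
  ext a b
  have h : MvPolynomial.X (a, I b) - MvPolynomial.C ((1 : Matrix (Fin d) (Fin d) F) a b) ∈
      chartIdeal F d m I := Ideal.subset_span ⟨(a, b), rfl⟩
  have h2 := (Ideal.Quotient.eq (I := chartIdeal F d m I)).2 h
  simp only [Matrix.submatrix_apply, id, genericMatrix, Matrix.of_apply]
  rw [h2]
  by_cases hab : a = b <;> simp [Matrix.one_apply, hab]

section
variable {F} {T : Type*} [CommRing T] [Algebra F T]
/-- The `T`-point of the chart `I` given by a matrix `M` with `M_I = 1`. -/
def evalHom (I : Fin d ↪o Fin m) (M : Matrix (Fin d) (Fin m) T)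
    (hM : M.submatrix id I = 1) : ChartRing F d m I →ₐ[F] T :=
  Ideal.Quotient.liftₐ (chartIdeal F d m I) (MvPolynomial.aeval fun p => M p.1 p.2) (by
    intro a ha
    have : chartIdeal F d m I ≤ RingHom.ker
        (MvPolynomial.aeval (R := F) fun p : Fin d × Fin m => M p.1 p.2) := by
      refine Ideal.span_le.2 ?_
      rintro _ ⟨⟨i, j⟩, rfl⟩
      have := congrFun (congrFun hM i) j
      simp only [Matrix.submatrix_apply, id] at this
      by_cases hij : i = j
      · subst hij; simp [RingHom.mem_ker, this]
      · simp [RingHom.mem_ker, this, hij]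
    exact this ha)

lemma evalHom_generic (I : Fin d ↪o Fin m) (M : Matrix (Fin d) (Fin m) T)
    (hM : M.submatrix id I = 1) :
    (genericMatrix F I).map (evalHom (F := F) I M hM) = M := by
  ext a b
  change MvPolynomial.aeval (R := F) (fun p : Fin d × Fin m => M p.1 p.2)
    (MvPolynomial.X (a, b)) = M a b
  simp

end

lemma chartRing_hom_ext {T : Type*} [CommRing T] (I : Fin d ↪o Fin m) (f g : ChartRing F d m I →+* T)
    (h₀ : f.comp (algebraMap F _) = g.comp (algebraMap F _))
    (h : (genericMatrix F I).map f = (genericMatrix F I).map g) : f = g := by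
  apply Ideal.Quotient.ringHom_ext
  apply MvPolynomial.ringHom_ext
  · intro r; exact congrArg (fun k : F →+* T => k r) h₀
  · rintro ⟨a, b⟩
    exact congrFun (congrFun h a) b

/-- The `J`-th minor of the matrix of coordinates on the chart `I`. -/
def minor (I J : Fin d ↪o Fin m) : ChartRing F d m I :=
  ((genericMatrix F I).submatrix id J).det

/-- The coordinate ring of the open subscheme of the chart `I` where the `J`-th minor is invertible. -/
abbrev OverlapRing (I J : Fin d ↪o Fin m) : Type u := Localization.Away (minor F I J)

/-- The matrix of coordinates on the overlap of `I` with `J`. -/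
def overlapMatrix (I J : Fin d ↪o Fin m) : Matrix (Fin d) (Fin m) (OverlapRing F I J) :=
  (genericMatrix F I).map (algebraMap _ _)

/-- `M ↦ M_J⁻¹ M`. -/
def normalizeAt {T : Type*} [CommRing T] (J : Fin d ↪o Fin m) (M : Matrix (Fin d) (Fin m) T) :
    Matrix (Fin d) (Fin m) T := (M.submatrix id J)⁻¹ * M

lemma normalize_submatrix {T : Type*} [CommRing T] (J K : Fin d ↪o Fin m)
    (M : Matrix (Fin d) (Fin m) T) :
    (normalizeAt J M).submatrix id K = (M.submatrix id J)⁻¹ * M.submatrix id K := rfl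

lemma normalize_self {T : Type*} [CommRing T] (J : Fin d ↪o Fin m)
    (M : Matrix (Fin d) (Fin m) T) (h : IsUnit (M.submatrix id J).det) :
    (normalizeAt J M).submatrix id J = 1 := by
  rw [normalize_submatrix, Matrix.nonsing_inv_mul _ h]

lemma normalize_of_eq_one {T : Type*} [CommRing T] (J : Fin d ↪o Fin m)
    (M : Matrix (Fin d) (Fin m) T) (h : M.submatrix id J = 1) : normalizeAt J M = M := by
  simp [normalizeAt, h]

lemma normalize_normalize {T : Type*} [CommRing T] (J K : Fin d ↪o Fin m)
    (M : Matrix (Fin d) (Fin m) T) (h : IsUnit (M.submatrix id J).det) :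
    normalizeAt K (normalizeAt J M) = normalizeAt K M := by
  conv_lhs => rw [normalizeAt, normalize_submatrix, Matrix.mul_inv_rev, normalizeAt]
  rw [Matrix.nonsing_inv_nonsing_inv _ h, Matrix.mul_assoc, ← Matrix.mul_assoc _ _ M,
    Matrix.mul_nonsing_inv _ h, Matrix.one_mul]
  rfl

lemma isUnit_normalize {T : Type*} [CommRing T] (J K : Fin d ↪o Fin m)
    (M : Matrix (Fin d) (Fin m) T) (hJ : IsUnit (M.submatrix id J).det)
    (hK : IsUnit (M.submatrix id K).det) : IsUnit ((normalizeAt J M).submatrix id K).det := by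
  rw [normalize_submatrix, Matrix.det_mul]
  exact (Matrix.isUnit_nonsing_inv_det _ hJ).mul hK

lemma map_submatrix_det {T T' : Type*} [CommRing T] [CommRing T'] (f : T →+* T')
    (J : Fin d ↪o Fin m) (M : Matrix (Fin d) (Fin m) T) :
    ((M.map f).submatrix id J).det = f (M.submatrix id J).det := by
  rw [RingHom.map_det]; rfl

lemma map_normalize {T T' : Type*} [CommRing T] [CommRing T'] (f : T →+* T')
    (J : Fin d ↪o Fin m) (M : Matrix (Fin d) (Fin m) T) (h : IsUnit (M.submatrix id J).det) :
    (normalizeAt J M).map f = normalizeAt J (M.map f) := by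
  have h1 : (M.map f).submatrix id J * (normalizeAt J M).map f = M.map f := by
    have : (M.map f).submatrix id J = (M.submatrix id J).map f := rfl
    rw [this, ← Matrix.map_mul, normalizeAt, ← Matrix.mul_assoc, Matrix.mul_nonsing_inv _ h,
      Matrix.one_mul]
  have h2 : IsUnit ((M.map f).submatrix id J).det := by
    rw [map_submatrix_det]; exact h.map f
  conv_rhs => rw [normalizeAt]
  conv_rhs => rw [← h1]
  rw [← Matrix.mul_assoc]
  have h3 : ((M.map f).submatrix id J * (normalizeAt J M).map f).submatrix id J
    = (M.map f).submatrix id J := by rw [h1]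
  rw [h3, Matrix.nonsing_inv_mul _ h2, Matrix.one_mul]

lemma isUnit_overlap (I J : Fin d ↪o Fin m) :
    IsUnit ((overlapMatrix F I J).submatrix id J).det := by
  rw [overlapMatrix, map_submatrix_det]
  exact IsLocalization.Away.algebraMap_isUnit (minor F I J)

lemma overlap_one (I J : Fin d ↪o Fin m) : (overlapMatrix F I J).submatrix id I = 1 := by
  have : (overlapMatrix F I J).submatrix id I =
    ((genericMatrix F I).submatrix id I).map (algebraMap _ (OverlapRing F I J)) := rfl
  rw [this, genericMatrix_submatrix, Matrix.map_one _ (map_zero _) (map_one _)]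

/-- The morphism `M ↦ M_J⁻¹ M` from the overlap of `I` with `J` to the chart `J`, on rings. -/
def transitionAux (I J : Fin d ↪o Fin m) : ChartRing F d m J →ₐ[F] OverlapRing F I J :=
  evalHom J (normalizeAt J (overlapMatrix F I J)) (normalize_self _ _ (isUnit_overlap F I J))

lemma isUnit_transitionAux (I J : Fin d ↪o Fin m) :
    IsUnit (transitionAux F I J (minor F J I)) := by
  have h := map_submatrix_det (transitionAux F I J).toRingHom I (genericMatrix F J)
  have h2 : (genericMatrix F J).map (transitionAux F I J).toRingHom = _ :=
    evalHom_generic (F := F) J _ (normalize_self _ _ (isUnit_overlap F I J))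
  rw [h2] at h
  change IsUnit ((transitionAux F I J).toRingHom ((genericMatrix F J).submatrix id I).det)
  rw [← h]
  exact isUnit_normalize _ _ _ (isUnit_overlap F I J) (by simp [overlap_one])

/-- The isomorphism `M ↦ M_J⁻¹ M` from the overlap of `I` with `J` to that of `J` with `I`, on rings. -/
def transition (I J : Fin d ↪o Fin m) : OverlapRing F J I →+* OverlapRing F I J :=
  IsLocalization.Away.lift (minor F J I) (g := (transitionAux F I J).toRingHom)
    (isUnit_transitionAux F I J)

lemma transition_comp (I J : Fin d ↪o Fin m) :
    (transition F I J).comp (algebraMap _ _) = (transitionAux F I J).toRingHom :=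
  IsLocalization.Away.lift_comp _ _

/-- The ring homomorphism `R → Γ(X)` that a morphism `X ⟶ Spec R` amounts to. -/
def pullbackHom {X : Scheme.{u}} {R : Type u} [CommRing R] (g : X ⟶ Spec (.of R)) :
    R →+* Γ(X, ⊤) := ((Scheme.ΓSpecIso (.of R)).inv ≫ g.appTop).hom

lemma toSpec_pullbackHom {X : Scheme.{u}} {R : Type u} [CommRing R] (g : X ⟶ Spec (.of R)) :
    X.toSpecΓ ≫ Spec.map (CommRingCat.ofHom (pullbackHom g)) = g := by
  simp only [pullbackHom, CommRingCat.ofHom_hom, Spec.map_comp]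
  rw [← Category.assoc, ← Scheme.toSpecΓ_naturality, Category.assoc,
    toSpecΓ_SpecMap_ΓSpecIso_inv, Category.comp_id]

lemma pullbackHom_toSpec {X : Scheme.{u}} {R : Type u} [CommRing R] (f : R →+* Γ(X, ⊤)) :
    pullbackHom (X.toSpecΓ ≫ Spec.map (CommRingCat.ofHom f)) = f := by
  have h : (Scheme.ΓSpecIso (.of R)).inv ≫ (X.toSpecΓ ≫ Spec.map (CommRingCat.ofHom f)).appTop
      = CommRingCat.ofHom f := by
    rw [Scheme.Hom.comp_appTop, Scheme.toSpecΓ_appTop, Iso.inv_comp_eq,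
      Scheme.ΓSpecIso_naturality]
  rw [pullbackHom, h]; rfl

lemma hom_ext_of_pullbackHom {X : Scheme.{u}} {R : Type u} [CommRing R] (g g' : X ⟶ Spec (.of R))
    (h : pullbackHom g = pullbackHom g') : g = g' := by
  rw [← toSpec_pullbackHom g, h, toSpec_pullbackHom]

lemma pullbackHom_comp {X : Scheme.{u}} {R R' : Type u} [CommRing R] [CommRing R']
    (g : X ⟶ Spec (.of R)) (f : R' →+* R) :
    pullbackHom (g ≫ Spec.map (CommRingCat.ofHom f)) = (pullbackHom g).comp f := by
  conv_lhs => rw [← toSpec_pullbackHom g, Category.assoc, ← Spec.map_comp, ← CommRingCat.ofHom_comp]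
  rw [pullbackHom_toSpec]

/-- The base scheme `Spec F`. -/
abbrev base : Scheme.{u} := Spec (.of F)

/-- The chart `I`. -/
abbrev chart (I : Fin d ↪o Fin m) : Scheme.{u} := Spec (.of (ChartRing F d m I))

/-- The open subscheme of the chart `I` where the `J`-th minor is invertible. -/
abbrev overlap (I J : Fin d ↪o Fin m) : Scheme.{u} := Spec (.of (OverlapRing F I J))

/-- The inclusion of the overlap of `I` with `J` into the chart `I`. -/
def overlapι (I J : Fin d ↪o Fin m) : overlap F I J ⟶ chart F I :=
  Spec.map (CommRingCat.ofHom (algebraMap _ _))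

instance (I J : Fin d ↪o Fin m) : IsOpenImmersion (overlapι F I J) :=
  inferInstanceAs (IsOpenImmersion (Spec.map (CommRingCat.ofHom
    (algebraMap (ChartRing F d m I) (Localization.Away (minor F I J))))))

/-- The isomorphism `M ↦ M_J⁻¹ M` of overlaps. -/
def overlapIso (I J : Fin d ↪o Fin m) : overlap F I J ⟶ overlap F J I :=
  Spec.map (CommRingCat.ofHom (transition F I J))

/-- The structure morphism of the chart `I`. -/
def chartStr (I : Fin d ↪o Fin m) : chart F I ⟶ base F :=
  Spec.map (CommRingCat.ofHom (algebraMap F (ChartRing F d m I)))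

/-- The matrix of global functions on `X` that a morphism to a chart amounts to. -/
def coord {I : Fin d ↪o Fin m} {X : Scheme.{u}} (g : X ⟶ chart F I) :
    Matrix (Fin d) (Fin m) Γ(X, ⊤) := (genericMatrix F I).map (pullbackHom g)

variable {F}
lemma coord_submatrix {I : Fin d ↪o Fin m} {X : Scheme.{u}} (g : X ⟶ chart F I) :
    (coord F g).submatrix id I = 1 := by
  have : (coord F g).submatrix id I =
    ((genericMatrix F I).submatrix id I).map (pullbackHom g) := rfl
  rw [this, genericMatrix_submatrix, Matrix.map_one _ (map_zero _) (map_one _)]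

lemma chart_hom_ext {I : Fin d ↪o Fin m} {X : Scheme.{u}} (g g' : X ⟶ chart F I)
    (h₀ : g ≫ chartStr F I = g' ≫ chartStr F I) (h : coord F g = coord F g') : g = g' := by
  apply hom_ext_of_pullbackHom
  refine chartRing_hom_ext F I _ _ ?_ h
  rw [← pullbackHom_comp, ← pullbackHom_comp]
  exact congrArg pullbackHom h₀

lemma coord_isUnit {I J : Fin d ↪o Fin m} {X : Scheme.{u}} (g : X ⟶ overlap F I J) :
    IsUnit ((coord F (g ≫ overlapι F I J)).submatrix id J).det := by
  rw [coord, overlapι, pullbackHom_comp, map_submatrix_det]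
  exact (IsLocalization.Away.algebraMap_isUnit (minor F I J)).map (pullbackHom g)

lemma coord_overlapIso {I J : Fin d ↪o Fin m} {X : Scheme.{u}} (g : X ⟶ overlap F I J) :
    coord F (g ≫ overlapIso F I J ≫ overlapι F J I) =
      normalizeAt J (coord F (g ≫ overlapι F I J)) := by
  rw [overlapIso, overlapι, ← Spec.map_comp, ← CommRingCat.ofHom_comp, coord, pullbackHom_comp,
    transition_comp, coord, overlapι, pullbackHom_comp]
  have h2 : (genericMatrix F J).map (transitionAux F I J).toRingHom = _ :=
    evalHom_generic (F := F) J _ (normalize_self _ _ (isUnit_overlap F I J))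
  have h3 : (genericMatrix F J).map ((pullbackHom g).comp (transitionAux F I J).toRingHom)
    = ((genericMatrix F J).map (transitionAux F I J).toRingHom).map (pullbackHom g) := rfl
  rw [h3, h2, map_normalize _ _ _ (isUnit_overlap F I J)]
  rfl

lemma overlapIso_str (I J : Fin d ↪o Fin m) :
    overlapIso F I J ≫ overlapι F J I ≫ chartStr F J = overlapι F I J ≫ chartStr F I := by
  simp only [overlapIso, overlapι, chartStr, ← Spec.map_comp, ← CommRingCat.ofHom_comp]
  congr 2
  rw [← RingHom.comp_assoc, transition_comp]
  exact (transitionAux F I J).comp_algebraMap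

lemma isUnit_pullbackHom_minor {I J : Fin d ↪o Fin m} {X : Scheme.{u}} (g : X ⟶ chart F I)
    (h : IsUnit ((coord F g).submatrix id J).det) : IsUnit (pullbackHom g (minor F I J)) := by
  rwa [coord, map_submatrix_det] at h

/-- A morphism to a chart on which a minor is invertible factors through the overlap. -/
def overlapLift {I J : Fin d ↪o Fin m} {X : Scheme.{u}} (g : X ⟶ chart F I)
    (h : IsUnit ((coord F g).submatrix id J).det) : X ⟶ overlap F I J :=
  X.toSpecΓ ≫ Spec.map (CommRingCat.ofHom
    (IsLocalization.Away.lift (minor F I J) (g := pullbackHom g)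
      (isUnit_pullbackHom_minor g h)))

lemma overlapLift_ι {I J : Fin d ↪o Fin m} {X : Scheme.{u}} (g : X ⟶ chart F I)
    (h : IsUnit ((coord F g).submatrix id J).det) : overlapLift g h ≫ overlapι F I J = g := by
  have := IsLocalization.Away.lift_comp (S := OverlapRing F I J) (minor F I J)
    (isUnit_pullbackHom_minor g h)
  rw [overlapLift, overlapι, Category.assoc, ← Spec.map_comp, ← CommRingCat.ofHom_comp, this,
    toSpec_pullbackHom]

variable (F)
lemma isUnit_triple (I J K : Fin d ↪o Fin m) :
    IsUnit ((coord F (pullback.fst (overlapι F I J) (overlapι F I K) ≫ overlapIso F I J ≫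
      overlapι F J I)).submatrix id K).det := by
  rw [coord_overlapIso]
  refine isUnit_normalize _ _ _ (coord_isUnit _) ?_
  rw [pullback.condition]
  exact coord_isUnit _

/-- The transition isomorphism on triple overlaps. -/
def tripleIso (I J K : Fin d ↪o Fin m) :
    pullback (overlapι F I J) (overlapι F I K) ⟶ pullback (overlapι F J K) (overlapι F J I) :=
  pullback.lift (overlapLift _ (isUnit_triple F I J K))
    (pullback.fst (overlapι F I J) (overlapι F I K) ≫ overlapIso F I J)
    (by rw [overlapLift_ι, Category.assoc])

lemma tripleIso_fst (I J K : Fin d ↪o Fin m) :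
    tripleIso F I J K ≫ pullback.fst (overlapι F J K) (overlapι F J I) ≫ overlapι F J K =
      pullback.fst (overlapι F I J) (overlapι F I K) ≫ overlapIso F I J ≫ overlapι F J I := by
  rw [pullback.condition, ← Category.assoc, tripleIso, pullback.lift_snd, Category.assoc]

lemma coord_tripleIso (I J K : Fin d ↪o Fin m) {X : Scheme.{u}}
    (h : X ⟶ pullback (overlapι F I J) (overlapι F I K)) :
    coord F ((h ≫ tripleIso F I J K) ≫
      pullback.fst (overlapι F J K) (overlapι F J I) ≫ overlapι F J K) =
      normalizeAt J (coord F (h ≫ pullback.fst _ _ ≫ overlapι F I J)) := by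
  rw [Category.assoc, tripleIso_fst, ← Category.assoc, coord_overlapIso, Category.assoc]

lemma tripleIso_str (I J K : Fin d ↪o Fin m) {X : Scheme.{u}}
    (h : X ⟶ pullback (overlapι F I J) (overlapι F I K)) :
    ((h ≫ tripleIso F I J K) ≫
      pullback.fst (overlapι F J K) (overlapι F J I) ≫ overlapι F J K) ≫ chartStr F J =
      (h ≫ pullback.fst _ _ ≫ overlapι F I J) ≫ chartStr F I := by
  rw [Category.assoc h, tripleIso_fst]
  simp only [Category.assoc]
  rw [overlapIso_str]

/-- The gluing of the charts along the isomorphisms `M ↦ M_J⁻¹ M`. There are no charts if `d > m`. -/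
def glueData (d m : ℕ) : Scheme.GlueData.{u} where
  J := ULift.{u} (Fin d ↪o Fin m)
  U I := chart F I.down
  V p := overlap F p.1.down p.2.down
  f I J := overlapι F I.down J.down
  f_id I := by
    have h : IsUnit (minor F I.down I.down) := by
      simp [minor, genericMatrix_submatrix]
    have e := IsLocalization.atUnit (ChartRing F d m I.down) (OverlapRing F I.down I.down) _ h
    have he : CommRingCat.ofHom (algebraMap (ChartRing F d m I.down)
        (OverlapRing F I.down I.down)) = e.toRingEquiv.toCommRingCatIso.hom := by
      exact CommRingCat.hom_ext (RingHom.ext fun x => (e.commutes x).symm)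
    have : IsIso (CommRingCat.ofHom (algebraMap (ChartRing F d m I.down)
      (OverlapRing F I.down I.down))) := by rw [he]; infer_instance
    unfold overlapι
    infer_instance
  f_open I J := by infer_instance
  t I J := overlapIso F I.down J.down
  t_id I := by
    rw [← cancel_mono (overlapι F I.down I.down)]
    apply chart_hom_ext
    · rw [Category.assoc, overlapIso_str, Category.id_comp]
    · rw [← Category.id_comp (_ ≫ _), coord_overlapIso, normalize_of_eq_one _ _ (coord_submatrix _)]
  t' I J K := tripleIso F I.down J.down K.down
  t_fac I J K := pullback.lift_snd _ _ _
  cocycle I J K := by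
    rw [← cancel_mono (pullback.fst _ _), ← cancel_mono (overlapι F _ _)]
    apply chart_hom_ext
    · have h1 := tripleIso_str F K.down I.down J.down
        (tripleIso F I.down J.down K.down ≫ tripleIso F J.down K.down I.down)
      have h2 := tripleIso_str F J.down K.down I.down (tripleIso F I.down J.down K.down)
      have h3 := tripleIso_str F I.down J.down K.down (𝟙 _)
      rw [Category.id_comp] at h3
      simp only [Category.assoc, Category.id_comp] at h1 h2 h3 ⊢
      rw [h1, h2, h3]
    · have h1 := coord_tripleIso F K.down I.down J.down
        (tripleIso F I.down J.down K.down ≫ tripleIso F J.down K.down I.down)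
      have h2 := coord_tripleIso F J.down K.down I.down (tripleIso F I.down J.down K.down)
      have h3 := coord_tripleIso F I.down J.down K.down (𝟙 _)
      rw [Category.id_comp] at h3
      simp only [Category.assoc, Category.id_comp] at h1 h2 h3 ⊢
      have hJ := coord_isUnit (F := F) (pullback.fst (overlapι F I.down J.down)
        (overlapι F I.down K.down))
      have hK := coord_isUnit (F := F) (pullback.snd (overlapι F I.down J.down)
        (overlapι F I.down K.down))
      rw [← pullback.condition] at hK
      rw [h1, h2, h3, normalize_normalize _ _ _ hJ, normalize_normalize _ _ _ hK,
        normalize_of_eq_one _ _ (coord_submatrix _)]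

/-- The structure morphism of the Grassmann scheme. -/
def str (d m : ℕ) : (glueData F d m).glued ⟶ base F :=
  Multicoequalizer.desc _ _ (fun I => chartStr F I.down) (by
    rintro ⟨I, J⟩
    change overlapι F I.down J.down ≫ chartStr F I.down =
      (overlapIso F I.down J.down ≫ overlapι F J.down I.down) ≫ chartStr F J.down
    rw [Category.assoc, overlapIso_str])

/-- The Grassmann scheme, as an `F`-scheme; it is empty if `d > m`. -/
def grassmann (d m : ℕ) : Over (base F) := Over.mk (str F d m)

/-- The inclusion of the chart `I` into the Grassmann scheme. -/
def chartι (I : Fin d ↪o Fin m) : chart F I ⟶ (grassmann F d m).left :=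
  (glueData F d m).ι ⟨I⟩

/-! Varieties, subprevarieties and rational points over a field -/

/-- An `F`-scheme is an `F`-variety if it is a finite union of open subschemes, each of which is the
spectrum of a finitely generated `F`-algebra. -/
def IsVariety (X : Over (base F)) : Prop :=
  ∃ (k : ℕ) (U : Fin k → X.left.Opens),
    (∀ i, IsAffineOpen (U i) ∧ (X.hom.appLE ⊤ (U i) le_top).hom.FiniteType) ∧ ⨆ i, U i = ⊤

/-- `i : Y ⟶ X` exhibits the `F`-variety `Y` as a subprevariety of the `F`-variety `X`: it is an
open immersion into a closed subvariety of `X` followed by the inclusion of the latter. -/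
def IsSubprevariety {X Y : Over (base F)} (i : Y ⟶ X) : Prop :=
  IsVariety F X ∧ IsVariety F Y ∧ ∃ (Z : Over (base F)) (j : Y ⟶ Z) (c : Z ⟶ X),
    IsVariety F Z ∧ IsOpenImmersion j.left ∧ IsClosedImmersion c.left ∧ j ≫ c = i

/-- The set `X(F)` of `F`-points of an `F`-scheme. -/
abbrev Points (X : Over (base F)) : Type u := Over.mk (𝟙 (base F)) ⟶ X

/-- The set of `d`-dimensional subspaces of `F^m`. -/
def Grassmannian (d m : ℕ) : Type u :=
  {N : Submodule F (Fin m → F) // Module.finrank F N = d}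

/-- The `F`-point `x` of the Grassmann scheme corresponds to the subspace `N`: for some chart `I`
containing `x`, the matrix of coordinates of `x` in this chart has row space `N`. -/
def CorrespondsTo {d m : ℕ} (x : Points F (grassmann F d m)) (N : Grassmannian F d m) : Prop :=
  ∃ (I : Fin d ↪o Fin m) (M : Matrix (Fin d) (Fin m) F) (hM : M.submatrix id I = 1),
    x.left = Spec.map (CommRingCat.ofHom (evalHom (F := F) I M hM).toRingHom) ≫ chartι F I ∧
      N.1 = Submodule.span F (Set.range M.row)

/-! Multisets, graded free modules and framed relation families -/

/-- A finite `n`-dimensional multiset `(V, μ)`, with `V ⊆ ℕⁿ` finite and `μ : V → ℕ_{≥ 1}`. -/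
structure FinMultiset (n : ℕ) where
  support : Finset (Fin n → ℕ)
  mult : support → ℕ
  one_le_mult : ∀ v, 1 ≤ mult v

variable {n : ℕ}

/-- The number of elements of a multiset, counted with multiplicity. -/
def FinMultiset.card (ξ : FinMultiset n) : ℕ := ∑ v, ξ.mult v

/-- The degree `u` part `F · x^u` of the `ℕⁿ`-graded ring `A = F[x₁, …, xₙ]`. -/
def polyPart (u : Fin n → ℕ) : Submodule F (MvPolynomial (Fin n) F) :=
  Submodule.span F {MvPolynomial.monomial (Finsupp.equivFunOnFinite.symm u) 1}

open scoped Classical in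
/-- The degree `w` part of the shifted module `A(v)`. -/
def shiftPart (v w : Fin n → ℕ) : Submodule F (MvPolynomial (Fin n) F) :=
  if v ≤ w then polyPart F (w - v) else ⊥

/-- The underlying `A`-module of the graded free module `⨁_{v ∈ V} A(v)^{μ(v)}`. -/
abbrev FreeModule (ξ : FinMultiset n) : Type u :=
  (Σ v : ξ.support, Fin (ξ.mult v)) → MvPolynomial (Fin n) F

/-- The degree `w` part of the graded free module `⨁_{v ∈ V} A(v)^{μ(v)}`. -/
def freePart (ξ : FinMultiset n) (w : Fin n → ℕ) : Submodule F (FreeModule F ξ) :=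
  Submodule.pi Set.univ fun p => shiftPart F p.1.1 w

/-- The dimension of the degree `w` part of the graded free module over `ξ`. -/
def delta (ξ : FinMultiset n) (w : Fin n → ℕ) : ℕ := Module.finrank F (freePart F ξ w)

/-- The identification of the index set of `⨁_{v ∈ V} F^{μ(v)}` with that of `F^{|ξ|}` along an
enumeration of `V`: the blocks are put one after the other, in the order of the enumeration. -/
def blockEquiv {ξ : FinMultiset n} {s : ℕ} (e : Fin s ≃ ξ.support) :
    (Σ v : ξ.support, Fin (ξ.mult v)) ≃ Fin ξ.card :=
  (Equiv.sigmaCongrLeft (β := fun v => Fin (ξ.mult v)) e).symm.trans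
    (finSigmaFinEquiv.trans (finCongr (Equiv.sum_comp e ξ.mult)))

/-- The projection `π_v : F^{|ξ|} = ⨁_{v ∈ V} F^{μ(v)} → F^{μ(v)}`. -/
def blockProj {ξ : FinMultiset n} {s : ℕ} (e : Fin s ≃ ξ.support) (v : ξ.support) :
    (Fin ξ.card → F) →ₗ[F] (Fin (ξ.mult v) → F) :=
  LinearMap.funLeft F F fun j => blockEquiv e ⟨v, j⟩

/-- The conditions on a framed relation family with respect to `(ξ₀, ξ₁)`. -/
structure IsFramed {ξ₀ ξ₁ : FinMultiset n} {s : ℕ} (e : Fin s ≃ ξ₀.support)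
    (L : ∀ w : ξ₁.support, Grassmannian F (delta F ξ₁ w.1) ξ₀.card) : Prop where
  proj_eq_bot : ∀ (w : ξ₁.support) (v : ξ₀.support), ¬ v.1 < w.1 →
    (L w).1.map (blockProj F e v) = ⊥
  mono : ∀ w v : ξ₁.support, v.1 < w.1 → (L v).1 ≤ (L w).1
  finrank_quotient : ∀ w : ξ₁.support,
    Module.finrank F ((L w).1 ⧸
      (⨆ v : {v : ξ₁.support // v.1 < w.1}, (L v.1).1).submoduleOf (L w).1) = ξ₁.mult w

/-- The set of framed relation families with respect to `(ξ₀, ξ₁)`. -/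
def FramedFamilies (ξ₀ ξ₁ : FinMultiset n) {s : ℕ} (e : Fin s ≃ ξ₀.support) :
    Set (∀ w : ξ₁.support, Grassmannian F (delta F ξ₁ w.1) ξ₀.card) :=
  {L | IsFramed F e L}

/-- The product over `F` of the Grassmann schemes with parameters `(δ₁(w), m₀)`, `w ∈ V₁`. -/
abbrev grassmannProduct (ξ₀ ξ₁ : FinMultiset n) : Over (base F) :=
  ∏ᶜ fun w : ξ₁.support => grassmann F (delta F ξ₁ w.1) ξ₀.card

end
end FramedRelations

/-! An `F`-point of a Grassmann scheme lies in some chart, since `Spec F` has a single point, and is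
there a normalized matrix over `F`. Two such matrices in charts `I` and `J` give the same point
exactly when `M' = M_J⁻¹ M`, that is, when their row spaces agree. As every subspace has a
normalized basis matrix, points are subspaces (`subspaceOf_bijective`), and by the universal
property points of the product are families of subspaces (`subspaces_bijective`).

It remains to see that the framed families form a locally closed set. On a product of charts each
`L_w` is the row space of a normalized matrix `M_w` of regular functions. Condition 1 says that
certain columns of `M_w` vanish. Condition 2 says `M_v = (M_v)_I M_w`, with `I` the chart of `L_w`.
Both are equations. Given condition 2, condition 3 says that the stacked matrix of the `M_v`, `v <
w`, has rank `δ₁(w) - μ₁(w)`; by minors this is an open condition intersected with a closed one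
(`isLocallyClosed_setOf_isFramed`).

Local closedness may be checked on the charts, so the framed points are the trace on the rational
points of a locally closed `O ∩ C` in the product. With the reduced structure on `C`, the open part
over `O` is a subprevariety, and its `F`-points are those located in `O ∩ C`, because `Spec F` is
reduced (`exists_isSubprevariety_of_isLocallyClosed`). -/

namespace FramedRelations
noncomputable section

/-! Row spaces and minors of matrices over a field -/

section RowSpaces
variable {F : Type*} [Field F] {ι κ : Type*}

/-- The row space of a matrix. -/
def rowSpan (M : Matrix ι κ F) : Submodule F (κ → F) := Submodule.span F (Set.range M.row)

lemma row_mem_rowSpan (M : Matrix ι κ F) (i : ι) : M i ∈ rowSpan M :=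
  Submodule.subset_span ⟨i, rfl⟩

lemma rowSpan_le_iff_exists_mul {ι' : Type*} [Fintype ι] (M : Matrix ι κ F) (M' : Matrix ι' κ F) :
    rowSpan M' ≤ rowSpan M ↔ ∃ A : Matrix ι' ι F, M' = A * M := by
  constructor
  · intro h
    have h' : ∀ i, ∃ c : ι → F, ∑ k, c k • M.row k = M' i := fun i =>
      (Submodule.mem_span_range_iff_exists_fun F).1 (h (row_mem_rowSpan M' i))
    choose c hc using h'
    refine ⟨Matrix.of c, ?_⟩
    ext i j
    rw [← hc i]
    simp [Matrix.mul_apply, Matrix.row]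
  · rintro ⟨A, rfl⟩
    refine Submodule.span_le.2 ?_
    rintro _ ⟨i, rfl⟩
    refine (Submodule.mem_span_range_iff_exists_fun F).2 ⟨A i, ?_⟩
    ext j
    simp [Matrix.mul_apply, Matrix.row]

/-- Row rank equals column rank, so `r` independent columns can be chosen, and they form an
invertible matrix. -/
lemma exists_minor_ne_zero [Fintype κ] {r : ℕ} (M : Matrix (Fin r) κ F)
    (h : LinearIndependent F M.row) : ∃ g : Fin r → κ, (M.submatrix id g).det ≠ 0 := by
  have hr : Module.finrank F (Submodule.span F (Set.range M.col)) = r := by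
    rw [← Matrix.rank_eq_finrank_span_cols, h.rank_matrix, Fintype.card_fin]
  obtain ⟨τ, a, ha, hs, hli⟩ := exists_linearIndependent' F M.col
  have : Finite τ := Finite.of_injective a ha
  have : Fintype τ := Fintype.ofFinite τ
  have hc : Fintype.card τ = r := by
    rw [← hr, ← hs, finrank_span_eq_card hli]
  let e := Fintype.equivFinOfCardEq hc
  refine ⟨a ∘ e.symm, ?_⟩
  have h2 : LinearIndependent F (M.submatrix id (a ∘ e.symm)).col :=
    hli.comp e.symm e.symm.injective
  rw [Matrix.linearIndependent_cols_iff_isUnit, Matrix.isUnit_iff_isUnit_det] at h2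
  exact h2.ne_zero

lemma linearIndependent_rows_of_minor_ne_zero {r : ℕ} (M : Matrix (Fin r) κ F)
    (g : Fin r → κ) (h : (M.submatrix id g).det ≠ 0) : LinearIndependent F M.row := by
  have h2 : LinearIndependent F (M.submatrix id g).row := by
    rw [Matrix.linearIndependent_rows_iff_isUnit, Matrix.isUnit_iff_isUnit_det]
    exact h.isUnit
  exact LinearIndependent.of_comp (LinearMap.funLeft F F g) h2

/-- Expresses a lower bound on the rank by nonvanishing of minors, an open condition. The selections
`f` and `g` need not be injective, since a repeated row or column makes the minor zero. -/
lemma le_finrank_rowSpan_iff [Fintype ι] [Fintype κ] (M : Matrix ι κ F) (r : ℕ) :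
    r ≤ Module.finrank F (rowSpan M) ↔
      ∃ (f : Fin r → ι) (g : Fin r → κ), (M.submatrix f g).det ≠ 0 := by
  constructor
  · intro h
    obtain ⟨τ, a, ha, hs, hli⟩ := exists_linearIndependent' F M.row
    have : Finite τ := Finite.of_injective a ha
    have : Fintype τ := Fintype.ofFinite τ
    rw [rowSpan, ← hs, finrank_span_eq_card hli] at h
    obtain ⟨k⟩ : Nonempty (Fin r ↪ τ) :=
      Function.Embedding.nonempty_of_card_le (by simpa using h)
    obtain ⟨g, hg⟩ := exists_minor_ne_zero (M.submatrix (a ∘ k) id) (hli.comp k k.injective)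
    exact ⟨a ∘ k, g, hg⟩
  · rintro ⟨f, g, h⟩
    have hli : LinearIndependent F (M.submatrix f id).row :=
      linearIndependent_rows_of_minor_ne_zero (M.submatrix f id) g h
    have hle : rowSpan (M.submatrix f id) ≤ rowSpan M := by
      refine Submodule.span_mono ?_
      rintro _ ⟨i, rfl⟩
      exact ⟨f i, rfl⟩
    have hd := finrank_span_eq_card hli
    rw [Fintype.card_fin] at hd
    calc r = Module.finrank F (rowSpan (M.submatrix f id)) := hd.symm
      _ ≤ _ := Submodule.finrank_mono hle

/-- Turns the dimension of a sum of subspaces into the rank of a single matrix, to which minors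
apply. -/
lemma rowSpan_stack {J : Type*} {ρ : J → Type*} (M : ∀ j, Matrix (ρ j) κ F) :
    rowSpan (Matrix.of fun (p : Σ j, ρ j) k => M p.1 p.2 k) = ⨆ j, rowSpan (M j) := by
  apply le_antisymm
  · refine Submodule.span_le.2 ?_
    rintro _ ⟨⟨j, a⟩, rfl⟩
    exact Submodule.mem_iSup_of_mem j (row_mem_rowSpan (M j) a)
  · refine iSup_le fun j => Submodule.span_mono ?_
    rintro _ ⟨a, rfl⟩
    exact ⟨⟨j, a⟩, rfl⟩

variable {d m : ℕ}

/-- In `M' = A * M` the columns in `I` force `A` to be `M'_I`. Containment thus needs no existential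
quantifier and becomes a system of polynomial equations. -/
lemma rowSpan_le_iff_of_submatrix_eq_one (I : Fin d ↪o Fin m)
    (M : Matrix (Fin d) (Fin m) F) (hM : M.submatrix id I = 1) (M' : Matrix ι (Fin m) F) :
    rowSpan M' ≤ rowSpan M ↔ M' = M'.submatrix id I * M := by
  rw [rowSpan_le_iff_exists_mul]
  constructor
  · rintro ⟨A, rfl⟩
    have : (A * M).submatrix id I = A * M.submatrix id I := rfl
    rw [this, hM, Matrix.mul_one]
  · exact fun h => ⟨_, h⟩

lemma finrank_rowSpan_of_submatrix_eq_one (I : Fin d ↪o Fin m)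
    (M : Matrix (Fin d) (Fin m) F) (hM : M.submatrix id I = 1) :
    Module.finrank F (rowSpan M) = d := by
  have h := linearIndependent_rows_of_minor_ne_zero M I (by simp [hM])
  rw [rowSpan, finrank_span_eq_card h, Fintype.card_fin]

lemma rowSpan_normalizeAt (J : Fin d ↪o Fin m) (M : Matrix (Fin d) (Fin m) F)
    (h : IsUnit (M.submatrix id J).det) : rowSpan (normalizeAt J M) = rowSpan M := by
  apply le_antisymm
  · exact (rowSpan_le_iff_exists_mul _ _).2 ⟨_, rfl⟩
  · refine (rowSpan_le_iff_exists_mul _ _).2 ⟨M.submatrix id J, ?_⟩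
    rw [normalizeAt, ← Matrix.mul_assoc, Matrix.mul_nonsing_inv _ h, Matrix.one_mul]

lemma eq_normalizeAt_of_rowSpan_eq (J : Fin d ↪o Fin m) (M M' : Matrix (Fin d) (Fin m) F)
    (hM' : M'.submatrix id J = 1) (h : rowSpan M' = rowSpan M) :
    IsUnit (M.submatrix id J).det ∧ M' = normalizeAt J M := by
  obtain ⟨A, rfl⟩ := (rowSpan_le_iff_exists_mul M M').1 h.le
  have h1 : A * M.submatrix id J = 1 := hM'
  have h2 : IsUnit (M.submatrix id J).det := Matrix.isUnit_det_of_left_inverse h1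
  refine ⟨h2, ?_⟩
  rw [normalizeAt, Matrix.inv_eq_left_inv h1]

lemma exists_orderEmbedding_minor_ne_zero (M : Matrix (Fin d) (Fin m) F) (g : Fin d → Fin m)
    (h : (M.submatrix id g).det ≠ 0) :
    ∃ I : Fin d ↪o Fin m, (M.submatrix id I).det ≠ 0 := by
  have hg : Function.Injective g := fun a b hab => by
    by_contra hne
    exact h (Matrix.det_zero_of_column_eq hne fun i => by simp [hab])
  let s : Finset (Fin m) := Finset.univ.image g
  have hs : s.card = d := by simp [s, Finset.card_image_of_injective _ hg]
  let I := s.orderEmbOfFin hs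
  have hσ : ∀ a, ∃ b, I b = g a := fun a => by
    have : g a ∈ Set.range I := by
      rw [Finset.range_orderEmbOfFin]; simp [s]
    exact this
  choose σ hσ using hσ
  refine ⟨I, fun h0 => h ?_⟩
  -- Sorting the columns chosen by `g` amounts to factoring out the 0-1 matrix of `σ`, so the minor
  -- at `g` is a multiple of the minor at `I`.
  have e : M.submatrix id g = M.submatrix id I * (1 : Matrix (Fin d) (Fin d) F).submatrix id σ := by
    ext a b
    simp [Matrix.mul_apply, Matrix.one_apply, hσ]
  rw [e, Matrix.det_mul, h0, zero_mul]

lemma exists_rowSpan_eq (N : Submodule F (Fin m → F)) (h : Module.finrank F N = d) :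
    ∃ (I : Fin d ↪o Fin m) (M : Matrix (Fin d) (Fin m) F), M.submatrix id I = 1 ∧
      N = rowSpan M := by
  let b := Module.finBasisOfFinrankEq F N h
  let B : Matrix (Fin d) (Fin m) F := Matrix.of fun i => (b i : Fin m → F)
  have hli : LinearIndependent F B.row :=
    b.linearIndependent.map' N.subtype (Submodule.ker_subtype N)
  have hN : rowSpan B = N := by
    have h1 : Set.range B.row = N.subtype '' Set.range b := by
      rw [← Set.range_comp]; rfl
    rw [rowSpan, h1, Submodule.span_image, b.span_eq, Submodule.map_top, Submodule.range_subtype]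
  obtain ⟨g, hg⟩ := exists_minor_ne_zero B hli
  obtain ⟨I, hI⟩ := exists_orderEmbedding_minor_ne_zero B g hg
  exact ⟨I, normalizeAt I B, normalize_self _ _ hI.isUnit,
    (hN.symm.trans (rowSpan_normalizeAt I B hI.isUnit).symm)⟩

end RowSpaces

/-! Loci defined by regular functions -/

section Loci
variable {F R E : Type*} [Field F] [CommRing R] [TopologicalSpace E] {ev : E → R →+* F}

/-- The hypothesis `hev` is all that is needed of the topology on `E`: nonvanishing loci of
functions are open. -/
lemma isClosed_setOf_eq (hev : ∀ f, IsOpen {y | ev y f ≠ 0}) (f g : R) :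
    IsClosed {y | ev y f = ev y g} := by
  have : {y | ev y f = ev y g} = {y | ev y (f - g) ≠ 0}ᶜ := by
    ext y; simp [sub_eq_zero]
  rw [this]
  exact (hev _).isClosed_compl

lemma isClosed_setOf_map_eq (hev : ∀ f, IsOpen {y | ev y f ≠ 0}) {ι κ : Type*}
    (A B : Matrix ι κ R) : IsClosed {y | A.map (ev y) = B.map (ev y)} := by
  have : {y | A.map (ev y) = B.map (ev y)} = ⋂ i, ⋂ k, {y | ev y (A i k) = ev y (B i k)} := by
    ext y
    simp [← Matrix.ext_iff]
  rw [this]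
  exact isClosed_iInter fun i => isClosed_iInter fun k => isClosed_setOf_eq hev _ _

lemma isOpen_setOf_le_finrank (hev : ∀ f, IsOpen {y | ev y f ≠ 0}) {ι κ : Type*} [Fintype ι]
    [Fintype κ] (A : Matrix ι κ R) (r : ℕ) :
    IsOpen {y | r ≤ Module.finrank F (rowSpan (A.map (ev y)))} := by
  have : {y | r ≤ Module.finrank F (rowSpan (A.map (ev y)))} =
      ⋃ (f : Fin r → ι), ⋃ (g : Fin r → κ), {y | ev y (A.submatrix f g).det ≠ 0} := by
    ext y
    simp only [le_finrank_rowSpan_iff, Set.mem_ofPred_eq, Set.mem_iUnion]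
    refine exists_congr fun f => exists_congr fun g => ?_
    rw [RingHom.map_det]
    rfl
  rw [this]
  exact isOpen_iUnion fun f => isOpen_iUnion fun g => hev _

lemma isLocallyClosed_setOf_finrank_eq (hev : ∀ f, IsOpen {y | ev y f ≠ 0}) {ι κ : Type*}
    [Fintype ι] [Fintype κ] (A : Matrix ι κ R) (r : ℕ) :
    IsLocallyClosed {y | Module.finrank F (rowSpan (A.map (ev y))) = r} := by
  have : {y | Module.finrank F (rowSpan (A.map (ev y))) = r} =
      {y | r ≤ Module.finrank F (rowSpan (A.map (ev y)))} ∩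
        {y | r + 1 ≤ Module.finrank F (rowSpan (A.map (ev y)))}ᶜ := by
    ext y
    simp only [Set.mem_ofPred_eq, Set.mem_inter_iff, Set.mem_compl_iff]
    omega
  rw [this]
  exact (isOpen_setOf_le_finrank hev A r).isLocallyClosed.inter
    (isOpen_setOf_le_finrank hev A (r + 1)).isClosed_compl.isLocallyClosed

lemma isLocallyClosed_setOf_finrank_iSup_add_eq (hev : ∀ f, IsOpen {y | ev y f ≠ 0}) {J κ : Type*}
    {ρ : J → Type*} [Finite J] [∀ j, Fintype (ρ j)] [Fintype κ] (A : ∀ j, Matrix (ρ j) κ R)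
    (k D : ℕ) : IsLocallyClosed {y | Module.finrank F
      (⨆ j, rowSpan ((A j).map (ev y)) : Submodule F (κ → F)) + k = D} := by
  -- Natural subtraction truncates, so the rank condition may be read as rank `D - k` only for `k ≤
  -- D`; otherwise the locus is empty.
  by_cases hk : k ≤ D
  · let _ := Fintype.ofFinite J
    have h := isLocallyClosed_setOf_finrank_eq hev
      (Matrix.of fun (p : Σ j, ρ j) k => A p.1 p.2 k) (D - k)
    convert! h using 3 with y
    rw [eq_tsub_iff_add_eq_of_le hk, ← rowSpan_stack]
    rfl
  · convert! isOpen_empty.isLocallyClosed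
    ext y
    simp only [Set.mem_ofPred_eq, Set.mem_empty_iff_false, iff_false]
    omega

lemma isLocallyClosed_iInter {X ι : Type*} [TopologicalSpace X] [Finite ι] {s : ι → Set X}
    (h : ∀ i, IsLocallyClosed (s i)) : IsLocallyClosed (⋂ i, s i) := by
  choose U Z hU hZ hs using h
  refine ⟨⋂ i, U i, ⋂ i, Z i, isOpen_iInter_of_finite hU, isClosed_iInter hZ, ?_⟩
  simp [hs, Set.iInter_inter_distrib]

end Loci

/-! ### The framed conditions in matrix coordinates -/

section FramedLocus
variable {F : Type u} [Field F]

lemma rowSpan_map_funLeft {ι κ κ' : Type*} (M : Matrix ι κ F) (g : κ' → κ) :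
    (rowSpan M).map (LinearMap.funLeft F F g) = rowSpan (M.submatrix id g) := by
  rw [rowSpan, Submodule.map_span, ← Set.range_comp]
  rfl

lemma rowSpan_eq_bot_iff {ι κ : Type*} (M : Matrix ι κ F) : rowSpan M = ⊥ ↔ M = 0 := by
  rw [rowSpan, Submodule.span_eq_bot]
  constructor
  · intro h
    funext i
    exact h _ ⟨i, rfl⟩
  · rintro rfl _ ⟨i, rfl⟩
    rfl

lemma finrank_quotient_submoduleOf_eq_iff {V : Type*} [AddCommGroup V] [Module F V]
    [FiniteDimensional F V] {S L : Submodule F V} (h : S ≤ L) (k : ℕ) :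
    Module.finrank F (L ⧸ S.submoduleOf L) = k ↔
      Module.finrank F S + k = Module.finrank F L := by
  have h1 := Submodule.finrank_quotient_add_finrank (S.submoduleOf L)
  rw [(Submodule.submoduleOfEquivOfLe h).finrank_eq] at h1
  omega

variable {n s : ℕ} {ξ₀ ξ₁ : FinMultiset n} (e : Fin s ≃ ξ₀.support)

/-- By condition 2 the sum of the smaller `L_v` lies in `L_w`, whose dimension is fixed to be
`δ₁(w)`. Condition 3 thus becomes a condition on the dimension of the sum alone. -/
lemma isFramed_iff (L : ∀ w : ξ₁.support, Grassmannian F (delta F ξ₁ w.1) ξ₀.card) :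
    IsFramed F e L ↔
      ((∀ (w : ξ₁.support) (v : ξ₀.support), ¬ v.1 < w.1 →
        (L w).1.map (blockProj F e v) = ⊥) ∧
      ∀ w v : ξ₁.support, v.1 < w.1 → (L v).1 ≤ (L w).1) ∧
      ∀ w : ξ₁.support, Module.finrank F
        (⨆ v : {v : ξ₁.support // v.1 < w.1}, (L v.1).1 : Submodule F (Fin ξ₀.card → F)) +
          ξ₁.mult w = delta F ξ₁ w.1 := by
  have key (hm : ∀ w v : ξ₁.support, v.1 < w.1 → (L v).1 ≤ (L w).1) (w : ξ₁.support) :=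
    finrank_quotient_submoduleOf_eq_iff (F := F)
      (S := ⨆ v : {v : ξ₁.support // v.1 < w.1}, (L v.1).1) (L := (L w).1)
      (iSup_le fun v => hm w v.1 v.2) (ξ₁.mult w)
  constructor
  · intro h
    exact ⟨⟨h.proj_eq_bot, h.mono⟩, fun w =>
      ((key h.mono w).1 (h.finrank_quotient w)).trans (L w).2⟩
  · rintro ⟨⟨h1, h2⟩, h3⟩
    exact ⟨h1, h2, fun w => (key h2 w).2 ((h3 w).trans (L w).2.symm)⟩

/-- In the coordinates given by normalized matrices, the framed relation families form a locally
closed set. -/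
lemma isLocallyClosed_setOf_isFramed {R E : Type*} [CommRing R] [TopologicalSpace E]
    {ev : E → R →+* F} (hev : ∀ f, IsOpen {y | ev y f ≠ 0})
    (I : ∀ w : ξ₁.support, Fin (delta F ξ₁ w.1) ↪o Fin ξ₀.card)
    (A : ∀ w : ξ₁.support, Matrix (Fin (delta F ξ₁ w.1)) (Fin ξ₀.card) R)
    (hA : ∀ w, (A w).submatrix id (I w) = 1)
    (L : E → ∀ w : ξ₁.support, Grassmannian F (delta F ξ₁ w.1) ξ₀.card)
    (hL : ∀ y w, (L y w).1 = rowSpan ((A w).map (ev y))) :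
    IsLocallyClosed {y | IsFramed F e (L y)} := by
  have hA' (w : ξ₁.support) (y : E) : ((A w).map (ev y)).submatrix id (I w) = 1 := by
    have : ((A w).map (ev y)).submatrix id (I w) = ((A w).submatrix id (I w)).map (ev y) := rfl
    rw [this, hA, Matrix.map_one _ (map_zero _) (map_one _)]
  simp only [isFramed_iff, hL]
  rw [Set.ofPred_and, Set.ofPred_and, Set.ofPred_forall, Set.ofPred_forall, Set.ofPred_forall]
  refine (IsClosed.inter (isClosed_iInter fun w => ?_) (isClosed_iInter fun w => ?_)).isLocallyClosed.inter
    (isLocallyClosed_iInter fun w => ?_)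
  · simp only [Set.ofPred_forall]
    refine isClosed_iInter fun v => isClosed_iInter fun _ => ?_
    -- The image under `π_v` is the row space of the block of columns belonging to `v`, so it
    -- vanishes exactly when this block does.
    have h := isClosed_setOf_map_eq hev
      ((A w).submatrix id fun j => blockEquiv e ⟨v, j⟩) 0
    simp only [blockProj, rowSpan_map_funLeft, rowSpan_eq_bot_iff]
    simpa only [Matrix.map_zero _ (map_zero _)] using! h
  · simp only [Set.ofPred_forall]
    refine isClosed_iInter fun v => isClosed_iInter fun _ => ?_
    have h := isClosed_setOf_map_eq hev (A v) ((A v).submatrix id (I w) * A w)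
    simp only [rowSpan_le_iff_of_submatrix_eq_one _ _ (hA' w _)]
    simpa only [Matrix.map_mul] using! h
  · have h := isLocallyClosed_setOf_finrank_iSup_add_eq hev
      (fun v : {v : ξ₁.support // v.1 < w.1} => A v.1) (ξ₁.mult w) (delta F ξ₁ w.1)
    have h2 (y : E) : (⨆ v : {v : ξ₁.support // v.1 < w.1}, (L y v.1).1) =
        ⨆ v : {v : ξ₁.support // v.1 < w.1}, rowSpan ((A v.1).map (ev y)) :=
      iSup_congr fun v => hL y v.1
    refine cast (congrArg IsLocallyClosed (Set.ext fun y => ?_)) h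
    exact iff_of_eq (congrArg (fun S : Submodule F (Fin ξ₀.card → F) =>
      Module.finrank F S + ξ₁.mult w = delta F ξ₁ w.1) (h2 y).symm)

end FramedLocus

/-! Rational points of the Grassmann scheme -/

section RationalPoints
variable {F : Type u} [Field F] {d m : ℕ}

/-- The identification of `F` with the ring of global functions on the base. -/
def baseHom (F : Type u) [Field F] : F →+* Γ(base F, ⊤) := pullbackHom (𝟙 (base F))

lemma baseHom_bijective : Function.Bijective (baseHom F) := by
  have : baseHom F = (Scheme.ΓSpecIso (.of F)).inv.hom := by
    simp [baseHom, pullbackHom]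
  rw [this]
  exact ConcreteCategory.bijective_of_isIso (Scheme.ΓSpecIso (.of F)).inv

/-- The inverse of `baseHom`. -/
def baseEquiv (F : Type u) [Field F] : F ≃+* Γ(base F, ⊤) :=
  RingEquiv.ofBijective (baseHom F) baseHom_bijective

/-- The `F`-point of the chart `I` with matrix `M`. -/
def chartPoint (I : Fin d ↪o Fin m) (M : Matrix (Fin d) (Fin m) F)
    (hM : M.submatrix id I = 1) : base F ⟶ chart F I :=
  Spec.map (CommRingCat.ofHom (evalHom (F := F) I M hM).toRingHom)

lemma chartPoint_str (I : Fin d ↪o Fin m) (M : Matrix (Fin d) (Fin m) F)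
    (hM : M.submatrix id I = 1) : chartPoint I M hM ≫ chartStr F I = 𝟙 _ := by
  rw [chartPoint, chartStr, ← Spec.map_comp, ← CommRingCat.ofHom_comp]
  have : (evalHom (F := F) I M hM).toRingHom.comp (algebraMap F (ChartRing F d m I)) =
      RingHom.id F := (evalHom (F := F) I M hM).comp_algebraMap
  rw [this, CommRingCat.ofHom_id, Spec.map_id]

lemma coord_chartPoint (I : Fin d ↪o Fin m) (M : Matrix (Fin d) (Fin m) F)
    (hM : M.submatrix id I = 1) : coord F (chartPoint I M hM) = M.map (baseEquiv F) := by
  have h : chartPoint I M hM = 𝟙 (base F) ≫ chartPoint I M hM := (Category.id_comp _).symm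
  conv_lhs => rw [h]
  rw [coord, chartPoint, pullbackHom_comp]
  conv_rhs => rw [← evalHom_generic (F := F) I M hM]
  rfl

/-- A morphism to a chart over the base is determined by its coordinates, which are elements of
`Γ(Spec F) = F`. -/
lemma eq_chartPoint (I : Fin d ↪o Fin m) (g : base F ⟶ chart F I) (hg : g ≫ chartStr F I = 𝟙 _) :
    ∃ hM, g = chartPoint I ((coord F g).map (baseEquiv F).symm) hM := by
  have hM : ((coord F g).map (baseEquiv F).symm).submatrix id I = 1 := by
    have : ((coord F g).map (baseEquiv F).symm).submatrix id I =
      ((coord F g).submatrix id I).map (baseEquiv F).symm := rfl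
    rw [this, coord_submatrix, Matrix.map_one _ (map_zero _) (map_one _)]
  refine ⟨hM, chart_hom_ext _ _ (by rw [hg, chartPoint_str]) ?_⟩
  rw [coord_chartPoint]
  ext a b
  simp

instance (I : Fin d ↪o Fin m) : IsOpenImmersion (chartι F I) :=
  (glueData F d m).ι_isOpenImmersion ⟨I⟩

lemma chartι_str (I : Fin d ↪o Fin m) : chartι F I ≫ (grassmann F d m).hom = chartStr F I :=
  Multicoequalizer.π_desc _ _ _ _ _

/-- As `Spec F` has one point, a single membership suffices to factor an `F`-point through an open
subscheme. -/
lemma range_subset_range_of_mem {X Y : Scheme.{u}} (x : base F ⟶ X) (g : Y ⟶ X) (p : base F)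
    (h : x p ∈ Set.range g) : Set.range x ⊆ Set.range g := by
  have : Subsingleton (base F) := inferInstanceAs (Subsingleton (PrimeSpectrum F))
  rintro _ ⟨q, rfl⟩
  rwa [Subsingleton.elim q p]

/-- The point of the base. -/
def basePt (F : Type u) [Field F] : base F := (⊥ : PrimeSpectrum F)

lemma exists_eq_chartPoint (x : Points F (grassmann F d m)) :
    ∃ (I : Fin d ↪o Fin m) (M : Matrix (Fin d) (Fin m) F) (hM : M.submatrix id I = 1),
      x.left = chartPoint I M hM ≫ chartι F I := by
  obtain ⟨⟨I⟩, y, hy⟩ := (glueData F d m).ι_jointly_surjective (x.left (basePt F))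
  have hr : Set.range x.left ⊆ Set.range (chartι F I) :=
    range_subset_range_of_mem _ _ (basePt F) ⟨y, hy⟩
  let g := IsOpenImmersion.lift (chartι F I) x.left hr
  have hgx : g ≫ chartι F I = x.left := IsOpenImmersion.lift_fac _ _ hr
  have hg : g ≫ chartStr F I = 𝟙 _ := by
    rw [← chartι_str, reassoc_of% hgx]
    exact Over.w x
  obtain ⟨hM, h⟩ := eq_chartPoint I g hg
  exact ⟨I, _, hM, by rw [← h, hgx]⟩

lemma overlapIso_chartι (I J : Fin d ↪o Fin m) :
    overlapIso F I J ≫ overlapι F J I ≫ chartι F J = overlapι F I J ≫ chartι F I :=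
  (glueData F d m).glue_condition ⟨I⟩ ⟨J⟩

/-- This is where the gluing enters: identification of points across charts is exactly `M' = M_J⁻¹
M`, the relation between normalized matrices with the same row space. -/
lemma chartPoint_chartι_eq_iff {I J : Fin d ↪o Fin m} {M M' : Matrix (Fin d) (Fin m) F}
    (hM : M.submatrix id I = 1) (hM' : M'.submatrix id J = 1) :
    chartPoint I M hM ≫ chartι F I = chartPoint J M' hM' ≫ chartι F J ↔
      rowSpan M = rowSpan M' := by
  have hinj : Function.Injective fun A : Matrix (Fin d) (Fin m) F => A.map (baseEquiv F) :=
    fun A B h => by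
      ext a b
      exact (baseEquiv F).injective (congrFun (congrFun h a) b)
  constructor
  · intro h
    -- The overlap is the fibre product of the two charts over the glued scheme, so points that
    -- agree there come from a point of the overlap.
    let g : base F ⟶ overlap F I J :=
      PullbackCone.IsLimit.lift ((glueData F d m).vPullbackConeIsLimit ⟨I⟩ ⟨J⟩)
        (chartPoint I M hM) (chartPoint J M' hM') h
    have h1 : g ≫ overlapι F I J = chartPoint I M hM :=
      PullbackCone.IsLimit.lift_fst ((glueData F d m).vPullbackConeIsLimit ⟨I⟩ ⟨J⟩) _ _ h
    have h2 : g ≫ overlapIso F I J ≫ overlapι F J I = chartPoint J M' hM' :=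
      PullbackCone.IsLimit.lift_snd ((glueData F d m).vPullbackConeIsLimit ⟨I⟩ ⟨J⟩) _ _ h
    have h3 := coord_overlapIso (F := F) g
    have h4 := coord_isUnit (F := F) g
    rw [h1, coord_chartPoint] at h4
    rw [h2, h1, coord_chartPoint, coord_chartPoint] at h3
    have h5 : IsUnit (M.submatrix id J).det := by
      have := map_submatrix_det (baseEquiv F : F →+* Γ(base F, ⊤)) J M
      rw [show M.map (baseEquiv F : F →+* Γ(base F, ⊤)) = M.map (baseEquiv F) from rfl] at this
      rw [this] at h4
      exact (MulEquiv.isUnit_map (baseEquiv F)).1 h4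
    have h6 := map_normalize (baseEquiv F : F →+* Γ(base F, ⊤)) J M h5
    have h7 : M' = normalizeAt J M := hinj (h3.trans h6.symm)
    rw [h7, rowSpan_normalizeAt J M h5]
  · intro h
    obtain ⟨h5, rfl⟩ := eq_normalizeAt_of_rowSpan_eq J M M' hM' h.symm
    have hu : IsUnit ((coord F (chartPoint I M hM)).submatrix id J).det := by
      rw [coord_chartPoint]
      have := map_submatrix_det (baseEquiv F : F →+* Γ(base F, ⊤)) J M
      exact this ▸ h5.map (baseEquiv F : F →+* Γ(base F, ⊤))
    have h1 := overlapLift_ι _ hu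
    have h2 : overlapLift _ hu ≫ overlapIso F I J ≫ overlapι F J I = chartPoint J _ hM' := by
      apply chart_hom_ext
      · simp only [Category.assoc]
        rw [overlapIso_str, reassoc_of% h1, chartPoint_str, chartPoint_str]
      · rw [coord_overlapIso, h1, coord_chartPoint, coord_chartPoint]
        exact (map_normalize (baseEquiv F : F →+* Γ(base F, ⊤)) J M h5).symm
    rw [← h2]
    simp only [Category.assoc]
    rw [overlapIso_chartι, reassoc_of% h1]

/-- The `F`-point of the Grassmann scheme with matrix `M` in the chart `I`. -/
def grassmannPoint (I : Fin d ↪o Fin m) (M : Matrix (Fin d) (Fin m) F)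
    (hM : M.submatrix id I = 1) : Points F (grassmann F d m) :=
  Over.homMk (chartPoint I M hM ≫ chartι F I) (by
    rw [Category.assoc, chartι_str, chartPoint_str]; rfl)

lemma existsUnique_correspondsTo (x : Points F (grassmann F d m)) :
    ∃! N : Grassmannian F d m, CorrespondsTo F x N := by
  obtain ⟨I, M, hM, hx⟩ := exists_eq_chartPoint x
  refine ⟨⟨rowSpan M, finrank_rowSpan_of_submatrix_eq_one I M hM⟩, ⟨I, M, hM, hx, rfl⟩, ?_⟩
  rintro ⟨N, hN⟩ ⟨J, M', hM', hx', rfl⟩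
  exact Subtype.ext ((chartPoint_chartι_eq_iff hM' hM).1 (hx'.symm.trans hx))

/-- The subspace corresponding to an `F`-point of the Grassmann scheme. -/
def subspaceOf (x : Points F (grassmann F d m)) : Grassmannian F d m :=
  (existsUnique_correspondsTo x).exists.choose

lemma correspondsTo_subspaceOf (x : Points F (grassmann F d m)) :
    CorrespondsTo F x (subspaceOf x) := (existsUnique_correspondsTo x).exists.choose_spec

lemma subspaceOf_eq {x : Points F (grassmann F d m)} {N : Grassmannian F d m}
    (h : CorrespondsTo F x N) : subspaceOf x = N :=
  (existsUnique_correspondsTo x).unique (correspondsTo_subspaceOf x) h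

lemma subspaceOf_bijective :
    Function.Bijective (subspaceOf : Points F (grassmann F d m) → Grassmannian F d m) := by
  constructor
  · intro x y h
    obtain ⟨I, M, hM, hx, hN⟩ := correspondsTo_subspaceOf x
    obtain ⟨J, M', hM', hy, hN'⟩ := correspondsTo_subspaceOf y
    ext1
    rw [hx, hy]
    refine (chartPoint_chartι_eq_iff hM hM').2 ?_
    exact hN.symm.trans ((congrArg Subtype.val h).trans hN')
  · rintro ⟨N, hN⟩
    obtain ⟨I, M, hM, rfl⟩ := exists_rowSpan_eq N hN
    exact ⟨grassmannPoint I M hM, subspaceOf_eq ⟨I, M, hM, rfl, rfl⟩⟩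

end RationalPoints

/-! The Zariski topology on the set of rational points -/

section ZariskiTopology
variable {F : Type u} [Field F]

/-- The point of the underlying space of `X` at which an `F`-point is located. -/
def location {X : Over (base F)} (y : Points F X) : X.left := y.left (basePt F)

/-- With the induced topology, a locally closed set of rational points is the trace of a locally
closed subset of the scheme. -/
instance (X : Over (base F)) : TopologicalSpace (Points F X) :=
  TopologicalSpace.induced location inferInstance

lemma isInducing_location (X : Over (base F)) :
    Topology.IsInducing (location : Points F X → X.left) := ⟨rfl⟩

/-- The global functions on `Spec F` form a field, so a nonzero pullback is a unit and its basic
open set is everything. -/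
lemma appTop_ne_zero_iff {W : Scheme.{u}} (g : base F ⟶ W) (f : Γ(W, ⊤)) :
    g.appTop f ≠ 0 ↔ g (basePt F) ∈ W.basicOpen f := by
  have h : g (basePt F) ∈ W.basicOpen f ↔ basePt F ∈ (base F).basicOpen (g.appTop f) := by
    rw [← Scheme.preimage_basicOpen_top]
    rfl
  rw [h]
  constructor
  · intro h0
    have hu : IsUnit (g.appTop f) := by
      obtain ⟨c, hc⟩ := (baseEquiv F).surjective (g.appTop f)
      rw [← hc] at h0 ⊢
      have : c ≠ 0 := fun h => h0 (by rw [h, map_zero])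
      exact this.isUnit.map (baseEquiv F)
    rw [Scheme.basicOpen_of_isUnit _ hu]
    trivial
  · intro h1 h0
    rw [h0, Scheme.basicOpen_zero] at h1
    exact h1

variable {X : Over (base F)} (U : X.left.Opens)

/-- An `F`-point located in the open subscheme `U` as a morphism to `U`. -/
def liftToOpen (y : Points F X) (hy : location y ∈ U) : base F ⟶ U.toScheme :=
  IsOpenImmersion.lift U.ι y.left (range_subset_range_of_mem _ _ (basePt F) (by simpa using! hy))

lemma liftToOpen_ι (y : Points F X) (hy : location y ∈ U) :
    liftToOpen U y hy ≫ U.ι = y.left := IsOpenImmersion.lift_fac _ _ _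

/-- The value of a function on `U` at an `F`-point located in `U`. -/
def evalAt (y : Points F X) (hy : location y ∈ U) : Γ(U.toScheme, ⊤) →+* F :=
  ((baseEquiv F).symm : Γ(base F, ⊤) →+* F).comp (liftToOpen U y hy).appTop.hom

/-- Provides the hypothesis `hev` for evaluation of functions at rational points. -/
lemma evalAt_ne_zero_iff (y : Points F X) (hy : location y ∈ U) (f : Γ(U.toScheme, ⊤)) :
    evalAt U y hy f ≠ 0 ↔ location y ∈ U.ι ''ᵁ U.toScheme.basicOpen f := by
  have h1 : evalAt U y hy f ≠ 0 ↔ (liftToOpen U y hy).appTop f ≠ 0 :=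
    (map_ne_zero_iff (baseEquiv F).symm (baseEquiv F).symm.injective)
  have h2 : location y = U.ι (liftToOpen U y hy (basePt F)) := by
    rw [← Scheme.Hom.comp_apply, liftToOpen_ι]
    rfl
  rw [h1, appTop_ne_zero_iff, h2]
  constructor
  · exact fun h => ⟨_, h, rfl⟩
  · rintro ⟨q, hq, hq'⟩
    rwa [← U.ι.injective hq']

lemma coord_comp {d m : ℕ} {I : Fin d ↪o Fin m} {W W' : Scheme.{u}} (h : W' ⟶ W)
    (g : W ⟶ chart F I) : coord F (h ≫ g) = (coord F g).map h.appTop.hom := by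
  have : pullbackHom (h ≫ g) = h.appTop.hom.comp (pullbackHom g) := by
    rw [pullbackHom, Scheme.Hom.comp_appTop]
    rfl
  rw [coord, this]
  rfl

/-- The subspaces given by a family of `F`-points located in a chart are row spaces of matrices of
functions. -/
lemma subspaceOf_comp_eq_rowSpan {d m : ℕ} {I : Fin d ↪o Fin m} (p : X ⟶ grassmann F d m)
    (c : U.toScheme ⟶ chart F I) (hc : c ≫ chartι F I = U.ι ≫ p.left)
    (y : Points F X) (hy : location y ∈ U) :
    (subspaceOf (y ≫ p)).1 = rowSpan ((coord F c).map (evalAt U y hy)) := by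
  have h1 : (liftToOpen U y hy ≫ c) ≫ chartι F I = (y ≫ p).left := by
    rw [Category.assoc, hc, ← Category.assoc, liftToOpen_ι]
    rfl
  have hg : (liftToOpen U y hy ≫ c) ≫ chartStr F I = 𝟙 _ := by
    rw [← chartι_str, ← Category.assoc, h1]
    exact Over.w (y ≫ p)
  obtain ⟨hM, h2⟩ := eq_chartPoint I _ hg
  have h3 : (subspaceOf (y ≫ p)).1 =
      rowSpan ((coord F (liftToOpen U y hy ≫ c)).map (baseEquiv F).symm) :=
    congrArg Subtype.val (subspaceOf_eq (N := ⟨_, finrank_rowSpan_of_submatrix_eq_one I _ hM⟩)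
      ⟨I, _, hM, h1.symm.trans (congrArg (· ≫ chartι F I) h2), rfl⟩)
  rw [h3, coord_comp]
  rfl

end ZariskiTopology

/-! ### Rational points of the product and the framed locus -/

section FramedPoints
variable {F : Type u} [Field F] {n s : ℕ} {ξ₀ ξ₁ : FinMultiset n} (e : Fin s ≃ ξ₀.support)

/-- The projection of the product of Grassmann schemes to its factor `w`. -/
def projection (ξ₀ ξ₁ : FinMultiset n) (w : ξ₁.support) :
    grassmannProduct F ξ₀ ξ₁ ⟶ grassmann F (delta F ξ₁ w.1) ξ₀.card :=
  Pi.π (fun w : ξ₁.support => grassmann F (delta F ξ₁ w.1) ξ₀.card) w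

/-- The open subscheme of the product of Grassmann schemes given by a chart of each factor. -/
def productChart (I : ∀ w : ξ₁.support, Fin (delta F ξ₁ w.1) ↪o Fin ξ₀.card) :
    (grassmannProduct F ξ₀ ξ₁).left.Opens :=
  ⟨⋂ w, (projection ξ₀ ξ₁ w).left ⁻¹' Set.range (chartι F (I w)),
    isOpen_iInter_of_finite fun w =>
      (chartι F (I w)).isOpenEmbedding.isOpen_range.preimage (projection ξ₀ ξ₁ w).left.continuous⟩

/-- The family of subspaces corresponding to an `F`-point of the product of Grassmann schemes. -/
def subspaces (y : Points F (grassmannProduct F ξ₀ ξ₁)) (w : ξ₁.support) :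
    Grassmannian F (delta F ξ₁ w.1) ξ₀.card := subspaceOf (y ≫ projection ξ₀ ξ₁ w)

lemma exists_mem_productChart (y : Points F (grassmannProduct F ξ₀ ξ₁)) :
    ∃ I : ∀ w : ξ₁.support, Fin (delta F ξ₁ w.1) ↪o Fin ξ₀.card, location y ∈ productChart I := by
  choose I M hM h using fun w => exists_eq_chartPoint (y ≫ projection ξ₀ ξ₁ w)
  refine ⟨I, Set.mem_iInter.2 fun w => ⟨chartPoint (I w) (M w) (hM w) (basePt F), ?_⟩⟩
  rw [← Scheme.Hom.comp_apply, ← h w]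
  rfl

lemma isLocallyClosed_setOf_isFramed_subspaces :
    IsLocallyClosed {y : Points F (grassmannProduct F ξ₀ ξ₁) | IsFramed F e (subspaces y)} := by
  let V (I : ∀ w : ξ₁.support, Fin (delta F ξ₁ w.1) ↪o Fin ξ₀.card) :
      TopologicalSpace.Opens (Points F (grassmannProduct F ξ₀ ξ₁)) :=
    ⟨location ⁻¹' productChart I,
      (productChart I).isOpen.preimage (isInducing_location _).continuous⟩
  have hV : TopologicalSpace.IsOpenCover V := by
    refine eq_top_iff.2 fun y _ => ?_
    obtain ⟨I, hI⟩ := exists_mem_productChart y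
    exact TopologicalSpace.Opens.mem_iSup.2 ⟨I, hI⟩
  -- Local closedness is local, and on each product chart the subspaces have matrices of regular
  -- functions.
  rw [hV.isLocallyClosed_iff_coe_preimage]
  intro I
  have hr (w : ξ₁.support) : Set.range ((productChart I).ι ≫ (projection ξ₀ ξ₁ w).left) ⊆
      Set.range (chartι F (I w)) := by
    rintro _ ⟨q, rfl⟩
    exact Set.mem_iInter.1 q.2 w
  let c (w : ξ₁.support) : (productChart I).toScheme ⟶ chart F (I w) :=
    IsOpenImmersion.lift (chartι F (I w)) _ (hr w)
  refine isLocallyClosed_setOf_isFramed e (ev := fun y : V I => evalAt (productChart I) y.1 y.2)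
    (fun f => ?_) I (fun w => coord F (c w)) (fun w => coord_submatrix (c w))
    (fun y => subspaces y.1) (fun y w => ?_)
  · simp only [evalAt_ne_zero_iff]
    exact ((productChart I).ι ''ᵁ _).isOpen.preimage
      ((isInducing_location _).continuous.comp continuous_subtype_val)
  · exact subspaceOf_comp_eq_rowSpan (productChart I) (projection ξ₀ ξ₁ w) (c w)
      (IsOpenImmersion.lift_fac _ _ _) y.1 y.2

lemma subspaces_bijective : Function.Bijective
    (subspaces : Points F (grassmannProduct F ξ₀ ξ₁) →
      ∀ w : ξ₁.support, Grassmannian F (delta F ξ₁ w.1) ξ₀.card) := by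
  constructor
  · intro y y' h
    exact Pi.hom_ext _ _ fun w => subspaceOf_bijective.1 (congrFun h w)
  · intro L
    choose x hx using fun w => subspaceOf_bijective.2 (L w)
    refine ⟨Pi.lift x, funext fun w => ?_⟩
    rw [subspaces, projection, Pi.lift_π, hx]

end FramedPoints

/-! Varieties and locally closed subsets -/

section Varieties
variable {F : Type u} [Field F]

/-- `F`-schemes of finite type. -/
def finiteType (F : Type u) [Field F] : ObjectProperty (Over (base F)) :=
  fun X => LocallyOfFiniteType X.hom ∧ QuasiCompact X.hom

lemma isVariety_of_finiteType {X : Over (base F)} (hX : finiteType F X) : IsVariety F X := by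
  obtain ⟨h1, h2⟩ := hX
  have : CompactSpace X.left := (quasiCompact_iff_compactSpace (f := X.hom)).1 h2
  let 𝒰 := X.left.affineCover.finiteSubcover
  obtain ⟨k, ⟨e⟩⟩ := Finite.exists_equiv_fin 𝒰.I₀
  refine ⟨k, fun i => (𝒰.f (e.symm i)).opensRange, fun i => ?_, ?_⟩
  · have : IsAffine (𝒰.X (e.symm i)) := inferInstanceAs (IsAffine (X.left.affineCover.X _))
    have ha : IsAffineOpen (𝒰.f (e.symm i)).opensRange := isAffineOpen_opensRange _
    exact ⟨ha, X.hom.finiteType_appLE (isAffineOpen_top _) ha _⟩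
  · rw [← 𝒰.iSup_opensRange]
    exact e.symm.iSup_comp (g := fun i => (𝒰.f i).opensRange)

instance : (finiteType F).IsClosedUnderIsomorphisms where
  of_iso {X Y} e hX := by
    have h : Y.hom = e.inv.left ≫ X.hom := (Over.w e.inv).symm
    have : IsIso e.inv.left := inferInstanceAs (IsIso ((Over.forget _).map e.inv))
    rw [finiteType, h]
    exact ⟨MorphismProperty.comp_mem @LocallyOfFiniteType _ _ inferInstance hX.1,
      MorphismProperty.comp_mem @QuasiCompact _ _ inferInstance hX.2⟩

lemma finiteType_of_isLimit {X Y : Over (base F)} {B : BinaryFan X Y} (hB : IsLimit B)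
    (hX : finiteType F X) (hY : finiteType F Y) : finiteType F B.pt := by
  have := hX.1; have := hX.2; have := hY.1; have := hY.2
  have hP : finiteType F (Over.mk (pullback.fst X.hom Y.hom ≫ X.hom)) :=
    ⟨inferInstanceAs (LocallyOfFiniteType (pullback.fst X.hom Y.hom ≫ X.hom)),
      inferInstanceAs (QuasiCompact (pullback.fst X.hom Y.hom ≫ X.hom))⟩
  have hB' := (pullback.isLimit X.hom Y.hom).pullbackConeEquivBinaryFanFunctor
  exact (finiteType F).prop_of_iso (hB'.conePointUniqueUpToIso hB) hP

/-- Finite products are built from the terminal object, which is the base itself, and binary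
products, which are fibre products over the base. -/
instance : (finiteType F).IsClosedUnderFiniteProducts := by
  have : MorphismProperty.ContainsIdentities @LocallyOfFiniteType.{u} :=
    MorphismProperty.IsMultiplicative.toContainsIdentities
  have : MorphismProperty.ContainsIdentities @QuasiCompact.{u} :=
    MorphismProperty.IsMultiplicative.toContainsIdentities
  have : MorphismProperty.RespectsIso @LocallyOfFiniteType.{u} :=
    MorphismProperty.IsStableUnderBaseChange.respectsIso
  have : MorphismProperty.RespectsIso @QuasiCompact.{u} :=
    MorphismProperty.IsStableUnderBaseChange.respectsIso
  have h1 := Over.closedUnderLimitsOfShape_discrete_empty (P := @LocallyOfFiniteType.{u})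
    (X := base F)
  have h2 := Over.closedUnderLimitsOfShape_discrete_empty (P := @QuasiCompact.{u}) (X := base F)
  have : (finiteType F).IsClosedUnderLimitsOfShape (Discrete.{0} PEmpty) := ⟨fun X h =>
    ⟨h1.limitsOfShape_le X (ObjectProperty.limitsOfShape_monotone _ (fun _ h => h.1) X h),
      h2.limitsOfShape_le X (ObjectProperty.limitsOfShape_monotone _ (fun _ h => h.2) X h)⟩⟩
  have : (finiteType F).IsClosedUnderBinaryProducts := ⟨fun X ⟨h⟩ =>
    finiteType_of_isLimit ((IsLimit.postcomposeHomEquiv (diagramIsoPair h.diag) _).symm h.isLimit)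
      (h.prop_diag_obj ⟨.left⟩) (h.prop_diag_obj ⟨.right⟩)⟩
  exact .mk'

lemma locallyOfFiniteType_chartStr {d m : ℕ} (I : Fin d ↪o Fin m) :
    LocallyOfFiniteType (chartStr F I) := by
  rw [chartStr, HasRingHomProperty.Spec_iff (P := @LocallyOfFiniteType)]
  have : Algebra.FiniteType F (ChartRing F d m I) := inferInstance
  exact (RingHom.finiteType_algebraMap).2 this

lemma finiteType_grassmann (d m : ℕ) : finiteType F (grassmann F d m) := by
  let 𝒰 := (glueData F d m).openCover
  constructor
  · have := HasRingHomProperty.instIsZariskiLocalAtSource (P := @LocallyOfFiniteType.{u})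
    refine IsZariskiLocalAtSource.of_openCover (P := @LocallyOfFiniteType.{u}) 𝒰 fun I => ?_
    have h : 𝒰.f I ≫ (grassmann F d m).hom = chartStr F (ULift.down I) := chartι_str (ULift.down I)
    exact h ▸ locallyOfFiniteType_chartStr (ULift.down I)
  · rw [quasiCompact_iff_compactSpace]
    have : Finite 𝒰.I₀ := inferInstanceAs (Finite (ULift.{u} (Fin d ↪o Fin m)))
    have (I : 𝒰.I₀) : CompactSpace (𝒰.X I) :=
      inferInstanceAs (CompactSpace (PrimeSpectrum (ChartRing F d m (ULift.down I))))
    exact 𝒰.compactSpace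

lemma finiteType_grassmannProduct {n : ℕ} (ξ₀ ξ₁ : FinMultiset n) :
    finiteType F (grassmannProduct F ξ₀ ξ₁) :=
  (finiteType F).prop_product fun _ => finiteType_grassmann _ _

/-- Since `Spec F` is reduced, the kernel of `x` is the vanishing ideal of the closure of its image,
and this closure lies in `C`. Hence `x` factors through the reduced structure on `C`. -/
lemma vanishingIdeal_le_ker {X : Scheme.{u}} {C : Set X} (hC : IsClosed C) (x : base F ⟶ X)
    (hx : x (basePt F) ∈ C) : Scheme.IdealSheafData.vanishingIdeal ⟨C, hC⟩ ≤ x.ker := by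
  have h : closure (Set.range x) ⊆ C := hC.closure_subset_iff.2
    (by simpa using range_subset_range_of_mem x (Scheme.IdealSheafData.vanishingIdeal
      ⟨C, hC⟩).subschemeι (basePt F) (by simpa using hx))
  rw [← Scheme.IdealSheafData.map_bot, ← Scheme.nilradical_eq_bot,
    ← Scheme.IdealSheafData.vanishingIdeal_top, Scheme.IdealSheafData.map_vanishingIdeal]
  refine Scheme.IdealSheafData.vanishingIdeal_antimono ?_
  rw [← SetLike.coe_subset_coe]
  simpa using! h

/-- A locally closed subset of an `F`-scheme of finite type is the underlying set of a
subprevariety, whose `F`-points are those located in the subset. -/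
lemma exists_isSubprevariety_of_isLocallyClosed {X : Over (base F)} (hX : finiteType F X)
    {T : Set X.left} (hT : IsLocallyClosed T) :
    ∃ (Y : Over (base F)) (i : Y ⟶ X), IsSubprevariety F i ∧ Mono i ∧
      ∀ x : Points F X, location x ∈ T ↔ ∃ y : Points F Y, y ≫ i = x := by
  obtain ⟨O, C, hO, hC, rfl⟩ := hT
  have := hX.1; have := hX.2
  let J : X.left.IdealSheafData := Scheme.IdealSheafData.vanishingIdeal ⟨C, hC⟩
  let Z : Over (base F) := Over.mk (J.subschemeι ≫ X.hom)
  let c : Z ⟶ X := Over.homMk J.subschemeι rfl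
  let V : J.subscheme.Opens := J.subschemeι ⁻¹ᵁ ⟨O, hO⟩
  let Y : Over (base F) := Over.mk (V.ι ≫ J.subschemeι ≫ X.hom)
  let j : Y ⟶ Z := Over.homMk V.ι rfl
  have hc : IsClosedImmersion c.left := inferInstanceAs (IsClosedImmersion J.subschemeι)
  have hj : IsOpenImmersion j.left := inferInstanceAs (IsOpenImmersion V.ι)
  have hZ : finiteType F Z := ⟨inferInstanceAs (LocallyOfFiniteType (J.subschemeι ≫ X.hom)),
    inferInstanceAs (QuasiCompact (J.subschemeι ≫ X.hom))⟩
  have hY : finiteType F Y := by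
    have := hZ.1; have := hZ.2
    -- Makes the open immersion into `Z` quasi-compact, so that `Y` is again of finite type.
    have : IsLocallyNoetherian Z.left := LocallyOfFiniteType.isLocallyNoetherian Z.hom
    have : IsLocallyNoetherian J.subscheme := this
    exact ⟨inferInstanceAs (LocallyOfFiniteType (V.ι ≫ Z.hom)),
      inferInstanceAs (QuasiCompact (V.ι ≫ Z.hom))⟩
  have hmono : Mono (j ≫ c).left := inferInstanceAs (Mono (V.ι ≫ J.subschemeι))
  refine ⟨Y, j ≫ c, ⟨isVariety_of_finiteType hX, isVariety_of_finiteType hY,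
    Z, j, c, isVariety_of_finiteType hZ, hj, hc, rfl⟩, Over.mono_of_mono_left _, fun x => ?_⟩
  constructor
  · rintro ⟨hxO, hxC⟩
    have hker : J.subschemeι.ker ≤ x.left.ker := by
      rw [Scheme.IdealSheafData.ker_subschemeι]
      exact vanishingIdeal_le_ker hC x.left hxC
    let g : base F ⟶ J.subscheme := IsClosedImmersion.lift J.subschemeι x.left hker
    have hg : g ≫ J.subschemeι = x.left := IsClosedImmersion.lift_fac _ _ hker
    have hgV : g (basePt F) ∈ V := by
      change (g ≫ J.subschemeι) (basePt F) ∈ O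
      rw [hg]
      exact hxO
    have hr : Set.range g ⊆ Set.range V.ι :=
      range_subset_range_of_mem _ _ (basePt F) (by simpa using hgV)
    let g' : base F ⟶ V.toScheme := IsOpenImmersion.lift V.ι g hr
    have hg' : g' ≫ V.ι = g := IsOpenImmersion.lift_fac _ _ hr
    refine ⟨Over.homMk g' ?_, ?_⟩
    · change g' ≫ V.ι ≫ J.subschemeι ≫ X.hom = 𝟙 _
      rw [reassoc_of% hg', reassoc_of% hg]
      exact Over.w x
    · ext1
      change g' ≫ V.ι ≫ J.subschemeι = x.left
      rw [reassoc_of% hg', hg]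
  · rintro ⟨y, rfl⟩
    let q : V.toScheme := y.left (basePt F)
    refine ⟨q.2, ?_⟩
    have h : J.subschemeι q.1 ∈ Set.range J.subschemeι := ⟨_, rfl⟩
    rw [Scheme.IdealSheafData.range_subschemeι] at h
    simpa [J] using! h

end Varieties

end
end FramedRelations

/-! ### The subprevariety of framed relation families -/

theorem mainTheorem7 {F : Type u} [Field F] {n : ℕ} (ξ₀ ξ₁ : FramedRelations.FinMultiset n)
    {s : ℕ} (e : Fin s ≃ ξ₀.support) :
    ∃ (Y : Over (FramedRelations.base F)) (i : Y ⟶ FramedRelations.grassmannProduct F ξ₀ ξ₁),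
      FramedRelations.IsSubprevariety F i ∧
      ∃ b : FramedRelations.Points F Y ≃ FramedRelations.FramedFamilies F ξ₀ ξ₁ e,
        ∀ (y : FramedRelations.Points F Y) (w : ξ₁.support),
          FramedRelations.CorrespondsTo F
            (y ≫ i ≫ Pi.π (fun w : ξ₁.support =>
              FramedRelations.grassmann F (FramedRelations.delta F ξ₁ w.1) ξ₀.card) w)
            ((b y).1 w) := by
  -- `T` need not be unique; only the rational points located in it matter.
  obtain ⟨T, hT, hTS⟩ := (FramedRelations.isInducing_location _).isLocallyClosed_iff.1
    (FramedRelations.isLocallyClosed_setOf_isFramed_subspaces (F := F) (ξ₁ := ξ₁) e)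
  obtain ⟨Y, i, hi, hmono, hpts⟩ := FramedRelations.exists_isSubprevariety_of_isLocallyClosed
    (FramedRelations.finiteType_grassmannProduct ξ₀ ξ₁) hT
  have hframed (x : FramedRelations.Points F (FramedRelations.grassmannProduct F ξ₀ ξ₁)) :
      (∃ y : FramedRelations.Points F Y, y ≫ i = x) ↔
        FramedRelations.IsFramed F e (FramedRelations.subspaces x) :=
    (hpts x).symm.trans (Set.ext_iff.1 hTS x)
  let f (y : FramedRelations.Points F Y) : FramedRelations.FramedFamilies F ξ₀ ξ₁ e :=
    ⟨FramedRelations.subspaces (y ≫ i), (hframed _).1 ⟨y, rfl⟩⟩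
  have hf : Function.Bijective f := by
    constructor
    · intro y y' h
      exact (cancel_mono i).1 (FramedRelations.subspaces_bijective.1 (congrArg Subtype.val h))
    · rintro ⟨L, hL⟩
      obtain ⟨x, rfl⟩ := FramedRelations.subspaces_bijective.2 L
      obtain ⟨y, rfl⟩ := (hframed x).2 hL
      exact ⟨y, rfl⟩
  refine ⟨Y, i, hi, Equiv.ofBijective f hf, fun y w => ?_⟩
  rw [← Category.assoc]
  exact FramedRelations.correspondsTo_subspaceOf _
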